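/- Let $n\ge 0$ and let $\mathcal G_n=\{i^kP_1\otimes\cdots\otimes P_n : k\in\{0,1,2,3\},\ P_j\in\{I,X,Y,Z\}\}$ be the $n$-qubit Pauli group acting on $(\mathbb C^2)^{\otimes n}$. A stabilizer state is a unit vector $|\psi\rangle\in(\mathbb C^2)^{\otimes n}$ for which exactly $2^n$ elements $P\in\mathcal G_n$ satisfy $P|\psi\rangle=|\psi\rangle$. A nearest-neighbor stabilizer state of a stabilizer state $|\psi\rangle$ is a stabilizer state $|\varphi\rangle$ for which $|\langle\psi|\varphi\rangle|$ attains the largest value different from $1$ that is possible among all stabilizer states $|\varphi\rangle$. Theorem. Let $|\psi\rangle$ be an $n$-qubit stabilizer state. (a) Counted up to global phase, $|\psi\rangle$ has exactly $4(2^n-1)$ nearest-neighbor stabilizer states. (b) If $n\ge 1$, the largest value different from $1$ of $|\langle\psi|\varphi\rangle|$ over stabilizer states $|\varphi\rangle$ is attained and equals $1/\sqrt2$. (c) Up to global phase, the nearest-neighbor stabilizer states of $|\psi\rangle$ are exactly the states $\dfrac{|\psi\rangle+P|\psi\rangle}{\sqrt2}$ with $P\in\mathcal G_n$ (the phase factors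 $i^k$ included) and $P|\psi\rangle$ orthogonal to $|\psi\rangle$. Moreover $|0\rangle^{\otimes n}$ is a stabilizer state, and up to global phase its nearest-neighbor stabilizer states are exactly the states $\dfrac{|0\rangle^{\otimes n}+i^t|x\rangle}{\sqrt2}$ with $x\in\{0,1\}^n$, $x\neq 0$, and $t\in\{0,1,2,3\}$. -/

import Mathlib

namespace QubitStab

noncomputable section

/-- The Hilbert space of `n` qubits, `(ℂ²)^{⊗ n}`, with orthonormal computational basis
indexed by the bit strings `Fin n → Fin 2`. -/
abbrev QubitSpace (n : ℕ) : Type := EuclideanSpace ℂ (Fin n → Fin 2)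

/-- The computational basis state `|x⟩`. -/
def basisState {n : ℕ} (x : Fin n → Fin 2) : QubitSpace n :=
  EuclideanSpace.single x 1

/-- The four Pauli literals. -/
inductive Literal where
  | I
  | X
  | Y
  | Z

/-- The `2 × 2` matrix of a Pauli literal. -/
def Literal.toMatrix : Literal → Matrix (Fin 2) (Fin 2) ℂ
  | .I => !![1, 0; 0, 1]
  | .X => !![0, 1; 1, 0]
  | .Y => !![0, -Complex.I; Complex.I, 0]
  | .Z => !![1, 0; 0, -1]

/-- The tensor product `P₁ ⊗ ⋯ ⊗ Pₙ` of Pauli matrices, as a matrix in the computational basis: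
its `(x, y)` entry is the product of the entries `(x j, y j)` of the factors. -/
def pauliString {n : ℕ} (p : Fin n → Literal) :
    Matrix (Fin n → Fin 2) (Fin n → Fin 2) ℂ :=
  Matrix.of fun x y => ∏ j, (p j).toMatrix (x j) (y j)

/-- The `n`-qubit Pauli group `{i^k P₁ ⊗ ⋯ ⊗ Pₙ}`, with `k ∈ {0,1,2,3}`, as a set of matrices. -/
def pauliGroup (n : ℕ) : Set (Matrix (Fin n → Fin 2) (Fin n → Fin 2) ℂ) :=
  {M | ∃ (k : Fin 4) (p : Fin n → Literal), M = Complex.I ^ (k : ℕ) • pauliString p}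

/-- The vector `M|ψ⟩`. -/
def applyMatrix {n : ℕ} (M : Matrix (Fin n → Fin 2) (Fin n → Fin 2) ℂ) (ψ : QubitSpace n) :
    QubitSpace n :=
  WithLp.toLp 2 (M.mulVec ψ.ofLp)

/-- The stabilizer group `S(|ψ⟩)`: the elements of the Pauli group that fix `|ψ⟩`. -/
def stabilizerGroup {n : ℕ} (ψ : QubitSpace n) :
    Set (Matrix (Fin n → Fin 2) (Fin n → Fin 2) ℂ) :=
  {M | M ∈ pauliGroup n ∧ applyMatrix M ψ = ψ}

/-- An `n`-qubit stabilizer state: a unit vector whose stabilizer group has `2 ^ n` elements. -/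
def IsStabilizerState {n : ℕ} (ψ : QubitSpace n) : Prop :=
  ‖ψ‖ = 1 ∧ (stabilizerGroup ψ).ncard = 2 ^ n

/-- The values different from `1` taken by `|⟨ψ|χ⟩|` as `χ` runs over the stabilizer states. -/
def overlapsNeOne {n : ℕ} (ψ : QubitSpace n) : Set ℝ :=
  {r | ∃ χ : QubitSpace n, IsStabilizerState χ ∧ ‖inner ℂ ψ χ‖ = r ∧ r ≠ 1}

/-- `φ` is a nearest stabilizer state to `ψ`: it is a stabilizer state and `|⟨ψ|φ⟩|` attains
the largest value different from `1` that is possible for stabilizer states. -/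
def IsNearestNeighbor {n : ℕ} (ψ φ : QubitSpace n) : Prop :=
  IsStabilizerState φ ∧ IsGreatest (overlapsNeOne ψ) ‖inner ℂ ψ φ‖

/-- The nearest stabilizer states to `ψ`, regarded as physical states, that is, up to
global phase (points of the projective space). -/
def nearestNeighborRays {n : ℕ} (ψ : QubitSpace n) : Set (Projectivization ℂ (QubitSpace n)) :=
  {L | ∃ (φ : QubitSpace n) (hφ : φ ≠ 0), IsNearestNeighbor ψ φ ∧ L = Projectivization.mk ℂ φ hφ}

/-- `φ` and `χ` agree up to a global phase. -/
def EqUpToPhase {n : ℕ} (φ χ : QubitSpace n) : Prop :=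
  ∃ c : ℂ, ‖c‖ = 1 ∧ φ = c • χ

/-- The unbiased superposition `(|ψ⟩ + |φ⟩)/√2`. -/
def superpose {n : ℕ} (ψ φ : QubitSpace n) : QubitSpace n :=
  ((√2 : ℝ) : ℂ)⁻¹ • (ψ + φ)

end

end QubitStab

namespace QubitStab

open scoped Matrix ComplexConjugate

noncomputable section

/-! Everything is read off from the real expectation values `expect p ψ`. The `4 ^ n` Pauli strings
form an orthogonal basis of the matrices, and the resulting completeness relation
`sum_inner_mul_conj_inner` says that the products of expectation values of two states sum to `2 ^ n`
times their squared overlap. For one unit vector the squares therefore sum to `2 ^ n`. As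
stabilizing elements correspond to strings of expectation `±1`, a unit vector is a stabilizer state
iff all its expectations are `0` or `±1` (`isStabilizerState_iff`).

Gap: if every string with nonzero expectation in `ψ` also has nonzero expectation in `φ`, then
either two signs disagree and the overlap is `0`, or all agree and the completeness sum gives
overlap `1`. Otherwise some `s • p` fixes `ψ` while `p` has expectation `0` in `φ`. Then `(φ + s p
φ)/√2` is a unit vector whose overlap with `ψ` is `√2` times that of `φ`. Cauchy–Schwarz gives the
bound `1/√2`, and its equality case, with the roles exchanged, gives the form of the neighbors.
Conversely, `isStabilizerState_superpose` shows that all such superpositions are stabilizer states.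

Count: `4 (4 ^ n - 2 ^ n)` phased strings send `ψ` to an orthogonal vector, each such vector arises
from `2 ^ n` of them, and different vectors give different rays. This leaves `4 (2 ^ n - 1)`. -/

instance : DecidableEq Literal := Classical.decEq _

instance : Fintype Literal :=
  ⟨{.I, .X, .Y, .Z}, fun l => by cases l <;> simp⟩

theorem Literal.sum_univ {M : Type*} [AddCommMonoid M] (f : Literal → M) :
    ∑ l, f l = f .I + (f .X + (f .Y + f .Z)) := by
  change ∑ l ∈ ({.I, .X, .Y, .Z} : Finset Literal), f l = _
  simp

theorem Literal.card_eq : Fintype.card Literal = 4 := by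
  rw [Fintype.card_eq_sum_ones, Literal.sum_univ]
  norm_num

/-! ### Fourth roots of unity -/

theorem exists_eq_I_pow {c : ℂ} (hc : c ^ 4 = 1) : ∃ k : Fin 4, c = Complex.I ^ (k : ℕ) := by
  have h : (c - 1) * (c + 1) * ((c - Complex.I) * (c + Complex.I)) = 0 := by
    linear_combination hc + (1 - c ^ 2) * Complex.I_sq
  rcases mul_eq_zero.1 h with h | h <;> rcases mul_eq_zero.1 h with h | h
  · exact ⟨0, by simpa using sub_eq_zero.1 h⟩
  · exact ⟨2, by simpa using eq_neg_of_add_eq_zero_left h⟩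
  · exact ⟨1, by simpa using sub_eq_zero.1 h⟩
  · exact ⟨3, by simpa [Complex.I_pow_three] using eq_neg_of_add_eq_zero_left h⟩

theorem I_pow_pow_four (k : ℕ) : (Complex.I ^ k) ^ 4 = 1 := by
  rw [← pow_mul, mul_comm, pow_mul, Complex.I_pow_four, one_pow]

theorem norm_eq_one_of_pow_four {c : ℂ} (hc : c ^ 4 = 1) : ‖c‖ = 1 :=
  Complex.norm_eq_one_of_pow_eq_one hc (by norm_num)

theorem I_pow_injective : Function.Injective fun k : Fin 4 => Complex.I ^ (k : ℕ) := by
  intro a b h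
  fin_cases a <;> fin_cases b <;>
    first
    | rfl
    | (exfalso; simp [Complex.ext_iff, Complex.I_pow_three] at h; try norm_num at h)

theorem add_conj_mem {c : ℂ} (hc : c ^ 4 = 1) :
    c + conj c = 0 ∨ c + conj c = 2 ∨ c + conj c = -2 := by
  obtain ⟨k, rfl⟩ := exists_eq_I_pow hc
  fin_cases k
  · right; left; norm_num
  · left; simp
  · right; right; norm_num
  · left; simp [Complex.I_pow_three]

/-! ### Products of Pauli matrices -/

theorem Literal.mul_eq (l m : Literal) :
    ∃ (c : ℂ) (r : Literal), c ^ 4 = 1 ∧ l.toMatrix * m.toMatrix = c • r.toMatrix := by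
  have h1 : (1 : ℂ) ^ 4 = 1 := one_pow _
  have h2 : Complex.I ^ 4 = 1 := Complex.I_pow_four
  have h3 : (-Complex.I) ^ 4 = 1 := by rw [Even.neg_pow (by decide), h2]
  cases l <;> cases m
  · exact ⟨1, .I, h1, by ext i j; fin_cases i <;> fin_cases j <;> simp [Literal.toMatrix]⟩
  · exact ⟨1, .X, h1, by ext i j; fin_cases i <;> fin_cases j <;> simp [Literal.toMatrix]⟩
  · exact ⟨1, .Y, h1, by ext i j; fin_cases i <;> fin_cases j <;> simp [Literal.toMatrix]⟩
  · exact ⟨1, .Z, h1, by ext i j; fin_cases i <;> fin_cases j <;> simp [Literal.toMatrix]⟩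
  · exact ⟨1, .X, h1, by ext i j; fin_cases i <;> fin_cases j <;> simp [Literal.toMatrix]⟩
  · exact ⟨1, .I, h1, by ext i j; fin_cases i <;> fin_cases j <;> simp [Literal.toMatrix]⟩
  · exact ⟨_, .Z, h2, by ext i j; fin_cases i <;> fin_cases j <;> simp [Literal.toMatrix]⟩
  · exact ⟨_, .Y, h3, by ext i j; fin_cases i <;> fin_cases j <;> simp [Literal.toMatrix]⟩
  · exact ⟨1, .Y, h1, by ext i j; fin_cases i <;> fin_cases j <;> simp [Literal.toMatrix]⟩
  · exact ⟨_, .Z, h3, by ext i j; fin_cases i <;> fin_cases j <;> simp [Literal.toMatrix]⟩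
  · exact ⟨1, .I, h1, by ext i j; fin_cases i <;> fin_cases j <;> simp [Literal.toMatrix]⟩
  · exact ⟨_, .X, h2, by ext i j; fin_cases i <;> fin_cases j <;> simp [Literal.toMatrix]⟩
  · exact ⟨1, .Z, h1, by ext i j; fin_cases i <;> fin_cases j <;> simp [Literal.toMatrix]⟩
  · exact ⟨_, .Y, h2, by ext i j; fin_cases i <;> fin_cases j <;> simp [Literal.toMatrix]⟩
  · exact ⟨_, .X, h3, by ext i j; fin_cases i <;> fin_cases j <;> simp [Literal.toMatrix]⟩
  · exact ⟨1, .I, h1, by ext i j; fin_cases i <;> fin_cases j <;> simp [Literal.toMatrix]⟩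

theorem Literal.mul_self (l : Literal) : l.toMatrix * l.toMatrix = 1 := by
  ext i j
  cases l <;> fin_cases i <;> fin_cases j <;> simp [Literal.toMatrix]

theorem Literal.mul_comm_or (l m : Literal) :
    ∃ s : ℂ, s ^ 2 = 1 ∧ l.toMatrix * m.toMatrix = s • (m.toMatrix * l.toMatrix) := by
  have key : l.toMatrix * m.toMatrix = (1 : ℂ) • (m.toMatrix * l.toMatrix) ∨
      l.toMatrix * m.toMatrix = (-1 : ℂ) • (m.toMatrix * l.toMatrix) := by
    cases l <;> cases m <;>
      solve
      | (left; ext i j; fin_cases i <;> fin_cases j <;> simp [Literal.toMatrix])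
      | (right; ext i j; fin_cases i <;> fin_cases j <;> simp [Literal.toMatrix])
  rcases key with h | h
  · exact ⟨1, by norm_num, h⟩
  · exact ⟨-1, by norm_num, h⟩

theorem Literal.conj_apply (l : Literal) (a b : Fin 2) :
    conj (l.toMatrix a b) = l.toMatrix b a := by
  cases l <;> fin_cases a <;> fin_cases b <;> simp [Literal.toMatrix]

/-- One-qubit completeness; taking products over the qubits gives `sum_pauliString_mul_conj`. -/
theorem Literal.sum_apply_mul_conj (a b c d : Fin 2) :
    ∑ l : Literal, l.toMatrix a b * conj (l.toMatrix c d) =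
      if a = c ∧ b = d then 2 else 0 := by
  rw [Literal.sum_univ]
  fin_cases a <;> fin_cases b <;> fin_cases c <;> fin_cases d <;>
    simp [Literal.toMatrix] <;> norm_num

theorem Literal.trace_mul (l m : Literal) :
    ∑ a, ∑ b, l.toMatrix a b * conj (m.toMatrix a b) = if l = m then 2 else 0 := by
  cases l <;> cases m <;> simp [Literal.toMatrix, Fin.sum_univ_two] <;> norm_num

variable {n : ℕ}

theorem sum_prod_apply {α : Type*} [Fintype α] (F : Fin n → α → ℂ) :
    ∑ p : Fin n → α, ∏ j, F j (p j) = ∏ j, ∑ a, F j a := by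
  rw [Finset.prod_univ_sum, Fintype.piFinset_univ]

theorem pauliString_apply (p : Fin n → Literal) (x y : Fin n → Fin 2) :
    pauliString p x y = ∏ j, (p j).toMatrix (x j) (y j) := rfl

theorem pauliString_mul_apply (p q : Fin n → Literal) (x y : Fin n → Fin 2) :
    (pauliString p * pauliString q) x y =
      ∏ j, ((p j).toMatrix * (q j).toMatrix) (x j) (y j) := by
  simp only [Matrix.mul_apply, pauliString_apply, ← Finset.prod_mul_distrib]
  rw [Finset.prod_univ_sum, Fintype.piFinset_univ]

theorem pauliString_mul (p q : Fin n → Literal) :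
    ∃ (c : ℂ) (r : Fin n → Literal), c ^ 4 = 1 ∧
      pauliString p * pauliString q = c • pauliString r := by
  choose c r hc h using Literal.mul_eq
  refine ⟨∏ j, c (p j) (q j), fun j => r (p j) (q j), ?_, ?_⟩
  · rw [← Finset.prod_pow]
    exact Finset.prod_eq_one fun j _ => hc _ _
  · ext x y
    rw [pauliString_mul_apply, Matrix.smul_apply, pauliString_apply, smul_eq_mul,
      ← Finset.prod_mul_distrib]
    simp [h]

theorem pauliString_mul_self (p : Fin n → Literal) : pauliString p * pauliString p = 1 := by
  ext x y
  rw [pauliString_mul_apply]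
  simp only [Literal.mul_self, Matrix.one_apply, Finset.prod_ite_zero, Finset.prod_const_one,
    Finset.mem_univ, true_imp_iff, funext_iff]

theorem pauliString_comm (p q : Fin n → Literal) :
    ∃ s : ℂ, (s = 1 ∨ s = -1) ∧
      pauliString p * pauliString q = s • (pauliString q * pauliString p) := by
  choose s hs h using Literal.mul_comm_or
  refine ⟨∏ j, s (p j) (q j), ?_, ?_⟩
  · refine eq_or_eq_neg_of_sq_eq_sq _ _ ?_
    rw [one_pow, ← Finset.prod_pow]
    exact Finset.prod_eq_one fun j _ => hs _ _
  · ext x y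
    rw [Matrix.smul_apply, pauliString_mul_apply, pauliString_mul_apply, smul_eq_mul,
      ← Finset.prod_mul_distrib]
    refine Finset.prod_congr rfl fun j _ => ?_
    rw [h (p j) (q j), Matrix.smul_apply, smul_eq_mul]

theorem pauliString_conjTranspose (p : Fin n → Literal) : (pauliString p)ᴴ = pauliString p := by
  ext x y
  simp [Matrix.conjTranspose_apply, pauliString_apply, Literal.conj_apply]

theorem sum_pauliString_mul_conj (x y z w : Fin n → Fin 2) :
    ∑ p : Fin n → Literal, pauliString p x y * conj (pauliString p z w) =
      if x = z ∧ y = w then 2 ^ n else 0 := by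
  simp only [pauliString_apply, map_prod, ← Finset.prod_mul_distrib]
  rw [sum_prod_apply fun j (l : Literal) => l.toMatrix (x j) (y j) * conj (l.toMatrix (z j) (w j))]
  simp only [Literal.sum_apply_mul_conj, Finset.prod_ite_zero, Finset.prod_const, Finset.mem_univ,
    true_imp_iff, funext_iff, forall_and, Finset.card_univ, Fintype.card_fin]

theorem pauliString_trace_mul (p q : Fin n → Literal) :
    ∑ x, ∑ y, pauliString p x y * conj (pauliString q x y) = if p = q then 2 ^ n else 0 := by
  have h : ∀ x : Fin n → Fin 2, ∑ y, pauliString p x y * conj (pauliString q x y) =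
      ∏ j, ∑ b, (p j).toMatrix (x j) b * conj ((q j).toMatrix (x j) b) := by
    intro x
    simp only [pauliString_apply, map_prod, ← Finset.prod_mul_distrib]
    rw [Finset.prod_univ_sum, Fintype.piFinset_univ]
  simp only [h]
  rw [sum_prod_apply fun j a => ∑ b, (p j).toMatrix a b * conj ((q j).toMatrix a b)]
  simp only [Literal.trace_mul, Finset.prod_ite_zero, Finset.prod_const, Finset.mem_univ,
    true_imp_iff, funext_iff, Finset.card_univ, Fintype.card_fin]

/-- Distinct strings are orthogonal for the trace form, so pairing with `pauliString p` separates
them. -/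
theorem eq_of_smul_pauliString_eq {c d : ℂ} (hc : c ≠ 0) {p q : Fin n → Literal}
    (h : c • pauliString p = d • pauliString q) : p = q := by
  by_contra hpq
  have h1 : ∑ x, ∑ y, (c • pauliString p) x y * conj (pauliString p x y) =
      ∑ x, ∑ y, (d • pauliString q) x y * conj (pauliString p x y) := by rw [h]
  simp only [Matrix.smul_apply, smul_eq_mul, mul_assoc, ← Finset.mul_sum,
    pauliString_trace_mul] at h1
  simp [Ne.symm hpq, hc] at h1

theorem mem_pauliGroup {M : Matrix (Fin n → Fin 2) (Fin n → Fin 2) ℂ} :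
    M ∈ pauliGroup n ↔ ∃ (c : ℂ) (p : Fin n → Literal), c ^ 4 = 1 ∧ M = c • pauliString p := by
  constructor
  · rintro ⟨k, p, rfl⟩
    exact ⟨_, p, I_pow_pow_four k, rfl⟩
  · rintro ⟨c, p, hc, rfl⟩
    obtain ⟨k, rfl⟩ := exists_eq_I_pow hc
    exact ⟨k, p, rfl⟩

/-! ### The action on vectors -/

theorem applyMatrix_add (M : Matrix (Fin n → Fin 2) (Fin n → Fin 2) ℂ) (a b : QubitSpace n) :
    applyMatrix M (a + b) = applyMatrix M a + applyMatrix M b := by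
  simp [applyMatrix, Matrix.mulVec_add]

theorem applyMatrix_smul (M : Matrix (Fin n → Fin 2) (Fin n → Fin 2) ℂ) (c : ℂ)
    (a : QubitSpace n) : applyMatrix M (c • a) = c • applyMatrix M a := by
  simp [applyMatrix, Matrix.mulVec_smul]

theorem smul_applyMatrix (c : ℂ) (M : Matrix (Fin n → Fin 2) (Fin n → Fin 2) ℂ)
    (a : QubitSpace n) : applyMatrix (c • M) a = c • applyMatrix M a := by
  simp [applyMatrix, Matrix.smul_mulVec]

theorem applyMatrix_mul (M N : Matrix (Fin n → Fin 2) (Fin n → Fin 2) ℂ) (a : QubitSpace n) :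
    applyMatrix (M * N) a = applyMatrix M (applyMatrix N a) := by
  simp [applyMatrix]

theorem one_applyMatrix (a : QubitSpace n) : applyMatrix 1 a = a := by
  simp [applyMatrix]

theorem inner_applyMatrix (M : Matrix (Fin n → Fin 2) (Fin n → Fin 2) ℂ) (a b : QubitSpace n) :
    inner ℂ a (applyMatrix M b) = inner ℂ (applyMatrix Mᴴ a) b := by
  have h : ∀ (N : Matrix (Fin n → Fin 2) (Fin n → Fin 2) ℂ) (v : QubitSpace n),
      applyMatrix N v = Matrix.toEuclideanLin N v := fun _ _ => rfl
  rw [h, h, Matrix.toEuclideanLin_conjTranspose_eq_adjoint, LinearMap.adjoint_inner_left]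

theorem inner_pauliString (p : Fin n → Literal) (a b : QubitSpace n) :
    inner ℂ a (applyMatrix (pauliString p) b) = inner ℂ (applyMatrix (pauliString p) a) b := by
  rw [inner_applyMatrix, pauliString_conjTranspose]

theorem pauliString_apply_apply (p : Fin n → Literal) (a : QubitSpace n) :
    applyMatrix (pauliString p) (applyMatrix (pauliString p) a) = a := by
  rw [← applyMatrix_mul, pauliString_mul_self, one_applyMatrix]

theorem inner_apply_apply (p : Fin n → Literal) (a b : QubitSpace n) :
    inner ℂ (applyMatrix (pauliString p) a) (applyMatrix (pauliString p) b) = inner ℂ a b := by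
  rw [inner_pauliString, pauliString_apply_apply]

theorem norm_pauliString_apply (p : Fin n → Literal) (a : QubitSpace n) :
    ‖applyMatrix (pauliString p) a‖ = ‖a‖ := by
  rw [@norm_eq_sqrt_re_inner ℂ, inner_apply_apply, ← @norm_eq_sqrt_re_inner ℂ]

theorem norm_pauliGroup_apply {P : Matrix (Fin n → Fin 2) (Fin n → Fin 2) ℂ}
    (hP : P ∈ pauliGroup n) (a : QubitSpace n) : ‖applyMatrix P a‖ = ‖a‖ := by
  obtain ⟨c, p, hc, rfl⟩ := mem_pauliGroup.1 hP
  rw [smul_applyMatrix, norm_smul, norm_eq_one_of_pow_four hc, one_mul, norm_pauliString_apply]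

/-! ### Completeness and expectation values -/

theorem sum_inner_mul_conj_inner (a b c d : QubitSpace n) :
    ∑ p : Fin n → Literal, inner ℂ a (applyMatrix (pauliString p) b) *
      conj (inner ℂ c (applyMatrix (pauliString p) d)) = 2 ^ n * (inner ℂ a c * inner ℂ d b) := by
  have h : ∀ (p : Fin n → Literal) (u v : QubitSpace n),
      inner ℂ u (applyMatrix (pauliString p) v) =
        ∑ t : (Fin n → Fin 2) × (Fin n → Fin 2), conj (u t.1) * v t.2 * pauliString p t.1 t.2 := by
    intro p u v
    rw [Fintype.sum_prod_type, PiLp.inner_apply]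
    refine Finset.sum_congr rfl fun x _ => ?_
    simp only [applyMatrix, Matrix.mulVec, dotProduct, RCLike.inner_apply, Finset.sum_mul]
    exact Finset.sum_congr rfl fun y _ => by ring
  have e : ∀ p : Fin n → Literal, inner ℂ a (applyMatrix (pauliString p) b) *
      conj (inner ℂ c (applyMatrix (pauliString p) d)) =
      ∑ t : (Fin n → Fin 2) × (Fin n → Fin 2), ∑ s : (Fin n → Fin 2) × (Fin n → Fin 2),
        conj (a t.1) * b t.2 * (c s.1 * conj (d s.2)) *
          (pauliString p t.1 t.2 * conj (pauliString p s.1 s.2)) := by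
    intro p
    rw [h, h, map_sum, Finset.sum_mul_sum]
    refine Finset.sum_congr rfl fun t _ => Finset.sum_congr rfl fun s _ => ?_
    simp only [map_mul, Complex.conj_conj]
    ring
  simp only [e]
  rw [Finset.sum_comm]
  have f : ∀ t : (Fin n → Fin 2) × (Fin n → Fin 2),
      ∑ p : Fin n → Literal, ∑ s : (Fin n → Fin 2) × (Fin n → Fin 2),
        conj (a t.1) * b t.2 * (c s.1 * conj (d s.2)) *
          (pauliString p t.1 t.2 * conj (pauliString p s.1 s.2)) =
      2 ^ n * ((conj (a t.1) * c t.1) * (conj (d t.2) * b t.2)) := by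
    intro t
    rw [Finset.sum_comm]
    simp only [← Finset.mul_sum, sum_pauliString_mul_conj, ← Prod.ext_iff]
    simp only [mul_ite, mul_zero, Finset.sum_ite_eq, Finset.mem_univ, if_true]
    ring
  simp only [f]
  rw [← Finset.mul_sum, Fintype.sum_prod_type, PiLp.inner_apply, PiLp.inner_apply,
    Finset.sum_mul_sum]
  simp only [RCLike.inner_apply, mul_comm]

/-- The expectation value `⟨ψ|p|ψ⟩` of a Pauli string. -/
def expect (p : Fin n → Literal) (ψ : QubitSpace n) : ℂ :=
  inner ℂ ψ (applyMatrix (pauliString p) ψ)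

theorem conj_expect (p : Fin n → Literal) (ψ : QubitSpace n) :
    conj (expect p ψ) = expect p ψ := by
  rw [expect, inner_conj_symm, ← inner_pauliString]

theorem sum_expect_mul (ψ φ : QubitSpace n) :
    ∑ p : Fin n → Literal, expect p ψ * expect p φ = 2 ^ n * ((‖inner ℂ ψ φ‖ ^ 2 : ℝ) : ℂ) := by
  have h := sum_inner_mul_conj_inner ψ ψ φ φ
  rw [← inner_conj_symm φ ψ, Complex.mul_conj, Complex.normSq_eq_norm_sq] at h
  rw [← h]
  exact Finset.sum_congr rfl fun p _ => by rw [← conj_expect p φ]; rfl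

theorem sum_norm_inner_sq {a b : QubitSpace n} (ha : ‖a‖ = 1) (hb : ‖b‖ = 1) :
    ∑ p : Fin n → Literal, ‖inner ℂ a (applyMatrix (pauliString p) b)‖ ^ 2 = (2 : ℝ) ^ n := by
  have h := sum_inner_mul_conj_inner a b a b
  simp only [Complex.mul_conj, Complex.normSq_eq_norm_sq, inner_self_eq_norm_sq_to_K, ha, hb] at h
  norm_num at h
  exact_mod_cast h

theorem apply_eq_of_expect {ψ : QubitSpace n} (hψ : ‖ψ‖ = 1) {p : Fin n → Literal}
    (h : expect p ψ = 1 ∨ expect p ψ = -1) :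
    applyMatrix (pauliString p) ψ = expect p ψ • ψ := by
  have hc : ‖expect p ψ‖ = 1 := by rcases h with h | h <;> simp [h]
  symm
  -- Unit vectors with inner product `1` coincide.
  rw [← inner_eq_one_iff_of_norm_eq_one (𝕜 := ℂ) (by rw [norm_smul, hc, hψ, one_mul])
    (by rw [norm_pauliString_apply, hψ]), inner_smul_left]
  change conj (expect p ψ) * expect p ψ = 1
  rw [conj_expect]
  rcases h with h | h <;> simp [h]

theorem expect_of_apply_eq {ψ : QubitSpace n} (hψ : ‖ψ‖ = 1) {p : Fin n → Literal} {c : ℂ}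
    (h : applyMatrix (pauliString p) ψ = c • ψ) :
    expect p ψ = c ∧ (c = 1 ∨ c = -1) := by
  have h1 : inner ℂ ψ ψ = (1 : ℂ) := by simp [inner_self_eq_norm_sq_to_K, hψ]
  refine ⟨by rw [expect, h, inner_smul_right, h1, mul_one], ?_⟩
  have h2 := pauliString_apply_apply p ψ
  rw [h, applyMatrix_smul, h, smul_smul] at h2
  have h3 : inner ℂ ψ ((c * c) • ψ) = (1 : ℂ) := by rw [h2, h1]
  rw [inner_smul_right, h1, mul_one] at h3
  exact mul_self_eq_one_iff.1 h3

open Classical in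
-- A string that fixes `ψ` up to a scalar does so with exactly one sign, namely its expectation, so
-- each such string contributes one group element.
theorem ncard_stabilizerGroup {ψ : QubitSpace n} (hψ : ‖ψ‖ = 1) :
    (stabilizerGroup ψ).ncard =
      (Finset.univ.filter fun p : Fin n → Literal => expect p ψ = 1 ∨ expect p ψ = -1).card := by
  have h : stabilizerGroup ψ = (fun p => expect p ψ • pauliString p) ''
      (Finset.univ.filter fun p : Fin n → Literal => expect p ψ = 1 ∨ expect p ψ = -1 :
        Finset (Fin n → Literal)) := by
    ext M
    simp only [Set.mem_image, Finset.mem_coe, Finset.mem_filter, Finset.mem_univ, true_and]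
    constructor
    · rintro ⟨hM, hMψ⟩
      obtain ⟨c, p, hc, rfl⟩ := mem_pauliGroup.1 hM
      have hc0 : c ≠ 0 := by rintro rfl; norm_num at hc
      rw [smul_applyMatrix] at hMψ
      obtain ⟨h1, h2⟩ := expect_of_apply_eq hψ (p := p) (c := c⁻¹)
        (by rw [eq_inv_smul_iff₀ hc0, hMψ])
      refine ⟨p, h1 ▸ h2, ?_⟩
      rw [h1]
      rcases h2 with h2 | h2
      · rw [inv_eq_one.1 h2, inv_one]
      · rw [h2, inv_eq_iff_eq_inv.1 h2]
        norm_num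
    · rintro ⟨p, hp, rfl⟩
      refine ⟨mem_pauliGroup.2 ⟨_, p, ?_, rfl⟩, ?_⟩
      · rcases hp with hp | hp <;> rw [hp] <;> norm_num
      · rw [smul_applyMatrix, apply_eq_of_expect hψ hp, smul_smul]
        rcases hp with hp | hp <;> simp [hp]
  rw [h, Set.InjOn.ncard_image, Set.ncard_coe_finset]
  intro p hp q _ hpq
  refine eq_of_smul_pauliString_eq ?_ hpq
  simp only [Finset.coe_filter, Finset.mem_univ, true_and, Set.mem_ofPred_eq] at hp
  rcases hp with hp | hp <;> rw [hp] <;> norm_num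

/-- The squared expectations sum to `2 ^ n`. The strings of expectation `±1` alone account for this
total exactly when all others contribute `0`. -/
theorem isStabilizerState_iff {ψ : QubitSpace n} :
    IsStabilizerState ψ ↔
      ‖ψ‖ = 1 ∧ ∀ p : Fin n → Literal, expect p ψ = 0 ∨ expect p ψ = 1 ∨ expect p ψ = -1 := by
  classical
  refine and_congr_right fun hψ => ?_
  rw [ncard_stabilizerGroup hψ]
  have hs : ∑ p : Fin n → Literal, ‖expect p ψ‖ ^ 2 = (2 : ℝ) ^ n := sum_norm_inner_sq hψ hψ
  rw [← Finset.sum_filter_add_sum_filter_not Finset.univ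
    (fun p : Fin n → Literal => expect p ψ = 1 ∨ expect p ψ = -1)] at hs
  have h1 : ∑ p : Fin n → Literal with expect p ψ = 1 ∨ expect p ψ = -1, ‖expect p ψ‖ ^ 2 =
      ((Finset.univ.filter
        fun p : Fin n → Literal => expect p ψ = 1 ∨ expect p ψ = -1).card : ℝ) := by
    rw [Finset.card_eq_sum_ones, Nat.cast_sum]
    refine Finset.sum_congr rfl fun p hp => ?_
    rcases (Finset.mem_filter.1 hp).2 with h | h <;> simp [h]
  rw [h1] at hs
  have h2 : (Finset.univ.filter
        fun p : Fin n → Literal => expect p ψ = 1 ∨ expect p ψ = -1).card = 2 ^ n ↔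
      ∑ p : Fin n → Literal with ¬(expect p ψ = 1 ∨ expect p ψ = -1), ‖expect p ψ‖ ^ 2 = 0 := by
    constructor
    · intro h
      rw [h] at hs
      push_cast at hs
      linarith
    · intro h
      rw [h, add_zero] at hs
      exact_mod_cast hs
  rw [h2, Finset.sum_eq_zero_iff_of_nonneg fun p _ => by positivity]
  simp only [Finset.mem_filter, Finset.mem_univ, true_and, pow_eq_zero_iff two_ne_zero,
    norm_eq_zero]
  exact forall_congr' fun p => by tauto

theorem IsStabilizerState.ne_zero {ψ : QubitSpace n} (hψ : IsStabilizerState ψ) : ψ ≠ 0 := by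
  rintro rfl
  simpa using hψ.1

theorem IsStabilizerState.inner_self {ψ : QubitSpace n} (hψ : IsStabilizerState ψ) :
    inner ℂ ψ ψ = (1 : ℂ) := by
  simp [inner_self_eq_norm_sq_to_K, hψ.1]

theorem IsStabilizerState.apply_eq {ψ : QubitSpace n} (hψ : IsStabilizerState ψ)
    {p : Fin n → Literal} (h : expect p ψ ≠ 0) :
    applyMatrix (pauliString p) ψ = expect p ψ • ψ :=
  apply_eq_of_expect hψ.1 (((isStabilizerState_iff.1 hψ).2 p).resolve_left h)

theorem IsStabilizerState.smul {ψ : QubitSpace n} (hψ : IsStabilizerState ψ) {c : ℂ}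
    (hc : ‖c‖ = 1) : IsStabilizerState (c • ψ) := by
  rw [isStabilizerState_iff] at hψ ⊢
  refine ⟨by rw [norm_smul, hc, hψ.1, one_mul], fun p => ?_⟩
  have : expect p (c • ψ) = expect p ψ := by
    rw [expect, applyMatrix_smul, inner_smul_left, inner_smul_right, ← mul_assoc, mul_comm (conj c),
      Complex.mul_conj, Complex.normSq_eq_norm_sq, hc]
    simp [expect]
  rw [this]
  exact hψ.2 p

theorem IsStabilizerState.sum_expect_sq {ψ : QubitSpace n} (hψ : IsStabilizerState ψ) :
    ∑ p : Fin n → Literal, expect p ψ * expect p ψ = 2 ^ n := by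
  rw [sum_expect_mul, hψ.inner_self]
  simp

/-! ### Superpositions -/

theorem sqrt_two_mul_inv : ((√2 : ℝ) : ℂ) * ((√2 : ℝ) : ℂ)⁻¹ = 1 :=
  mul_inv_cancel₀ (by simp)

theorem inv_sqrt_two_sq : ((√2 : ℝ) : ℂ)⁻¹ * ((√2 : ℝ) : ℂ)⁻¹ = 1 / 2 := by
  rw [← mul_inv, ← Complex.ofReal_mul, Real.mul_self_sqrt (by norm_num)]
  norm_num

theorem inner_superpose_self (ψ χ : QubitSpace n) :
    inner ℂ (superpose ψ χ) (superpose ψ χ) =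
      (1 / 2 : ℂ) * (inner ℂ ψ ψ + inner ℂ χ χ + inner ℂ ψ χ + inner ℂ χ ψ) := by
  simp only [superpose, inner_smul_left, inner_smul_right, inner_add_left, inner_add_right,
    map_inv₀, Complex.conj_ofReal]
  linear_combination (inner ℂ ψ ψ + inner ℂ χ χ + inner ℂ ψ χ + inner ℂ χ ψ) * inv_sqrt_two_sq

theorem norm_superpose {ψ χ : QubitSpace n} (hψ : ‖ψ‖ = 1) (hχ : ‖χ‖ = 1)
    (h : inner ℂ ψ χ = (0 : ℂ)) : ‖superpose ψ χ‖ = 1 := by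
  have h' : inner ℂ χ ψ = (0 : ℂ) := by rw [← inner_conj_symm, h, map_zero]
  have := inner_superpose_self ψ χ
  simp only [inner_self_eq_norm_sq_to_K, hψ, hχ, h, h'] at this
  have h2 : ((‖superpose ψ χ‖ ^ 2 : ℝ) : ℂ) = 1 := by
    rw [Complex.ofReal_pow]
    refine Eq.trans this ?_
    norm_num
  exact (pow_eq_one_iff_of_nonneg (norm_nonneg _) two_ne_zero).1 (by exact_mod_cast h2)

theorem inner_superpose {ψ χ : QubitSpace n} (hψ : ‖ψ‖ = 1) (h : inner ℂ ψ χ = (0 : ℂ)) :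
    inner ℂ ψ (superpose ψ χ) = ((√2 : ℝ) : ℂ)⁻¹ := by
  rw [superpose, inner_smul_right, inner_add_right, h]
  simp [inner_self_eq_norm_sq_to_K, hψ]

theorem norm_inner_superpose {ψ χ : QubitSpace n} (hψ : ‖ψ‖ = 1) (h : inner ℂ ψ χ = (0 : ℂ)) :
    ‖inner ℂ ψ (superpose ψ χ)‖ = 1 / √2 := by
  rw [inner_superpose hψ h, norm_inv, Complex.norm_real, Real.norm_of_nonneg (Real.sqrt_nonneg 2),
    one_div]

/-- The expectation of `q` splits into a diagonal part, doubled or cancelled as `q` commutes or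
anticommutes with `p`, and a cross part governed by `q p = d r`. At most one part is nonzero, and
each takes only the values `0` and `±1`. -/
theorem isStabilizerState_superpose {ψ : QubitSpace n} (hψ : IsStabilizerState ψ)
    {P : Matrix (Fin n → Fin 2) (Fin n → Fin 2) ℂ} (hP : P ∈ pauliGroup n)
    (h : inner ℂ ψ (applyMatrix P ψ) = (0 : ℂ)) :
    IsStabilizerState (superpose ψ (applyMatrix P ψ)) := by
  rw [isStabilizerState_iff]
  refine ⟨norm_superpose hψ.1 (by rw [norm_pauliGroup_apply hP, hψ.1]) h, fun q => ?_⟩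
  obtain ⟨c, p, hc, rfl⟩ := mem_pauliGroup.1 hP
  obtain ⟨s, hs, hqp⟩ := pauliString_comm q p
  obtain ⟨d, r, hd, hr⟩ := pauliString_mul q p
  rw [smul_applyMatrix, inner_smul_right] at h
  have hc0 : c ≠ 0 := by rintro rfl; norm_num at hc
  have hp : expect p ψ = 0 := (mul_eq_zero.1 h).resolve_left hc0
  have hcc : conj c * c = 1 := by
    rw [mul_comm, Complex.mul_conj, Complex.normSq_eq_norm_sq, norm_eq_one_of_pow_four hc]
    simp
  -- the diagonal and cross terms of the expectation value
  have e1 : inner ℂ (applyMatrix (pauliString p) ψ)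
      (applyMatrix (pauliString q) (applyMatrix (pauliString p) ψ)) = s * expect q ψ := by
    rw [← applyMatrix_mul, hqp, smul_applyMatrix, inner_smul_right, applyMatrix_mul,
      inner_apply_apply, expect]
  have e2 : inner ℂ ψ (applyMatrix (pauliString q) (applyMatrix (pauliString p) ψ)) =
      d * expect r ψ := by
    rw [← applyMatrix_mul, hr, smul_applyMatrix, inner_smul_right, expect]
  have e3 : inner ℂ (applyMatrix (pauliString p) ψ) (applyMatrix (pauliString q) ψ) =
      conj (d * expect r ψ) := by
    rw [← e2, inner_conj_symm, inner_pauliString, ← inner_pauliString, inner_pauliString q]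
  have hval : expect q (superpose ψ (applyMatrix (c • pauliString p) ψ)) =
      1 / 2 * ((1 + s) * expect q ψ + (c * d * expect r ψ + conj (c * d * expect r ψ))) := by
    rw [expect, superpose, applyMatrix_smul, applyMatrix_add, smul_applyMatrix, applyMatrix_smul]
    simp only [inner_smul_left, inner_smul_right, inner_add_left, inner_add_right, map_inv₀,
      Complex.conj_ofReal, e1, e2, e3, map_mul]
    rw [show inner ℂ ψ (applyMatrix (pauliString q) ψ) = expect q ψ from rfl]
    linear_combination (1 / 2 * s * expect q ψ) * hcc +
      (expect q ψ + c * d * expect r ψ + conj c * c * s * expect q ψ +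
        conj c * conj d * conj (expect r ψ)) * inv_sqrt_two_sq
  -- If `q` fixes `ψ` up to sign, then `⟨ψ|q p|ψ⟩` is `±⟨ψ|p|ψ⟩ = 0`.
  have hcross : expect q ψ ≠ 0 → expect r ψ = 0 := by
    intro hq
    have h2 := e2
    rw [inner_pauliString, hψ.apply_eq hq, inner_smul_left] at h2
    change _ * expect p ψ = _ at h2
    rw [hp, mul_zero] at h2
    refine (mul_eq_zero.1 h2.symm).resolve_left ?_
    rintro rfl
    norm_num at hd
  rw [hval]
  have hψ' := (isStabilizerState_iff.1 hψ).2
  by_cases hq : expect q ψ = 0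
  · rw [hq]
    -- Only the cross part remains: the real part of a fourth root of unity.
    have h4 : ∀ t : ℂ, t ^ 4 = 1 → 1 / 2 * ((1 + s) * 0 + (t + conj t)) = 0 ∨
        1 / 2 * ((1 + s) * 0 + (t + conj t)) = 1 ∨
        1 / 2 * ((1 + s) * 0 + (t + conj t)) = -1 := by
      intro t ht
      rcases add_conj_mem ht with h | h | h <;> rw [h]
      · left; ring
      · right; left; ring
      · right; right; ring
    rcases hψ' r with h | h | h
    · left; rw [h]; simp
    · refine h4 _ ?_
      rw [h, mul_one, mul_pow, hc, hd, one_mul]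
    · refine h4 _ ?_
      rw [h, mul_pow, mul_pow, hc, hd]; norm_num
  · rw [hcross hq]
    rcases hs with rfl | rfl
    · have : 1 / 2 * ((1 + 1) * expect q ψ + (c * d * 0 + conj (c * d * 0))) = expect q ψ := by
        rw [mul_zero, map_zero]; ring
      rw [this]
      exact hψ' q
    · left
      simp

/-! ### The gap in the overlaps -/

/-- Since `s • p` is self-adjoint and fixes `ψ`, both summands have the same overlap with `ψ`, and
`2/√2 = √2`. -/
theorem inner_superpose_of_fixed {ψ φ : QubitSpace n} (p : Fin n → Literal) {s : ℂ}
    (hs : s = 1 ∨ s = -1) (hp : applyMatrix (pauliString p) ψ = s • ψ) :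
    inner ℂ (superpose φ (applyMatrix (s • pauliString p) φ)) ψ =
      ((√2 : ℝ) : ℂ) * inner ℂ φ ψ := by
  have h : conj s * s = 1 := by rcases hs with rfl | rfl <;> simp
  rw [superpose, inner_smul_left, inner_add_left, smul_applyMatrix, inner_smul_left,
    ← inner_pauliString, hp, inner_smul_right, ← mul_assoc, h, one_mul, ← two_mul, map_inv₀,
    Complex.conj_ofReal]
  have h2 : ((√2 : ℝ) : ℂ) * ((√2 : ℝ) : ℂ) = 2 := by
    rw [← Complex.ofReal_mul, Real.mul_self_sqrt (by norm_num)]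
    norm_num
  have h3 : ((√2 : ℝ) : ℂ)⁻¹ * 2 = ((√2 : ℝ) : ℂ) := by
    rw [← h2, ← mul_assoc, mul_comm (_⁻¹), sqrt_two_mul_inv, one_mul]
  rw [← mul_assoc, h3]

theorem inner_eq_zero_of_fixed {ψ φ : QubitSpace n} (p : Fin n → Literal)
    (hψ : applyMatrix (pauliString p) ψ = (1 : ℂ) • ψ)
    (hφ : applyMatrix (pauliString p) φ = (-1 : ℂ) • φ) : inner ℂ ψ φ = (0 : ℂ) := by
  have h := inner_pauliString p ψ φ
  rw [hψ, hφ, inner_smul_left, inner_smul_right, map_one] at h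
  linear_combination (-1 / 2) * h

/-- Two stabilizer states have overlap `0` or `1`, or a Pauli string stabilizes the first up to
sign and has vanishing expectation value in the second. -/
theorem exists_expect_eq_zero {ψ φ : QubitSpace n} (hψ : IsStabilizerState ψ)
    (hφ : IsStabilizerState φ) (h0 : inner ℂ ψ φ ≠ (0 : ℂ)) (h1 : ‖inner ℂ ψ φ‖ ≠ 1) :
    ∃ p, expect p ψ ≠ 0 ∧ expect p φ = 0 := by
  by_contra! hne
  have hψ' := (isStabilizerState_iff.1 hψ).2
  have hφ' := (isStabilizerState_iff.1 hφ).2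
  -- Opposite signs would put the states in different eigenspaces of `p`, contradicting `h0`.
  have key : ∀ p, expect p ψ * expect p φ = expect p ψ * expect p ψ := by
    intro p
    by_cases hp : expect p ψ = 0
    · rw [hp, zero_mul, zero_mul]
    have a1 := hψ.apply_eq hp
    have a2 := hφ.apply_eq (hne p hp)
    rcases (hψ' p).resolve_left hp with e1 | e1 <;>
      rcases (hφ' p).resolve_left (hne p hp) with e2 | e2 <;> rw [e1] at a1 ⊢ <;> rw [e2] at a2 ⊢
    · exact absurd (inner_eq_zero_of_fixed p a1 a2) h0
    · exact absurd (by rw [← inner_conj_symm, inner_eq_zero_of_fixed p a2 a1, map_zero]) h0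
  have hs := sum_expect_mul ψ φ
  simp only [key] at hs
  rw [hψ.sum_expect_sq] at hs
  have h2 : (2 : ℂ) ^ n ≠ 0 := pow_ne_zero _ two_ne_zero
  have h3 : ((‖inner ℂ ψ φ‖ ^ 2 : ℝ) : ℂ) = 1 := by
    apply mul_left_cancel₀ h2
    rw [← hs, mul_one]
  have h4 : ‖inner ℂ ψ φ‖ ^ 2 = 1 := by exact_mod_cast h3
  exact h1 ((pow_eq_one_iff_of_nonneg (norm_nonneg _) two_ne_zero).1 h4)

theorem norm_inner_le {ψ φ : QubitSpace n} (hψ : IsStabilizerState ψ)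
    (hφ : IsStabilizerState φ) (h1 : ‖inner ℂ ψ φ‖ ≠ 1) : ‖inner ℂ ψ φ‖ ≤ 1 / √2 := by
  by_cases h0 : inner ℂ ψ φ = (0 : ℂ)
  · rw [h0, norm_zero]; positivity
  obtain ⟨p, hp, hq⟩ := exists_expect_eq_zero hψ hφ h0 h1
  have hs := ((isStabilizerState_iff.1 hψ).2 p).resolve_left hp
  have h := inner_superpose_of_fixed (φ := φ) p hs (hψ.apply_eq hp)
  have hn : ‖superpose φ (applyMatrix (expect p ψ • pauliString p) φ)‖ = 1 := by
    refine norm_superpose hφ.1 ?_ ?_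
    · rw [smul_applyMatrix, norm_smul, norm_pauliString_apply, hφ.1]
      rcases hs with hs | hs <;> simp [hs]
    · rw [smul_applyMatrix, inner_smul_right]
      exact mul_eq_zero_of_right _ hq
  have hle := norm_inner_le_norm (𝕜 := ℂ)
    (superpose φ (applyMatrix (expect p ψ • pauliString p) φ)) ψ
  rw [h, hn, hψ.1, norm_mul, Complex.norm_real, Real.norm_of_nonneg (Real.sqrt_nonneg 2),
    norm_inner_symm] at hle
  rw [le_div_iff₀ (by positivity)]
  linarith

theorem one_div_sqrt_two_ne_one : 1 / √2 ≠ 1 := by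
  intro h
  rw [div_eq_one_iff_eq (by positivity)] at h
  have := Real.sq_sqrt (show (0 : ℝ) ≤ 2 by norm_num)
  rw [← h] at this
  norm_num at this

/-- A stabilizer state with overlap `1/√2` is a superposition with a Pauli image. -/
theorem exists_eqUpToPhase_superpose {ψ φ : QubitSpace n} (hψ : IsStabilizerState ψ)
    (hφ : IsStabilizerState φ) (h : ‖inner ℂ ψ φ‖ = 1 / √2) :
    ∃ P ∈ pauliGroup n, inner ℂ ψ (applyMatrix P ψ) = 0 ∧
      EqUpToPhase φ (superpose ψ (applyMatrix P ψ)) := by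
  rw [norm_inner_symm] at h
  have h0 : inner ℂ φ ψ ≠ (0 : ℂ) := by
    rw [← norm_ne_zero_iff, h]; positivity
  -- Roles exchanged: `p` fixes `φ` up to sign, so that the superposition is built on `ψ`.
  obtain ⟨p, hp, hq⟩ := exists_expect_eq_zero hφ hψ h0 (by rw [h]; exact one_div_sqrt_two_ne_one)
  have hs := ((isStabilizerState_iff.1 hφ).2 p).resolve_left hp
  have hi := inner_superpose_of_fixed (φ := ψ) p hs (hφ.apply_eq hp)
  have hP : expect p φ • pauliString p ∈ pauliGroup n :=
    mem_pauliGroup.2 ⟨_, p, by rcases hs with hs | hs <;> rw [hs] <;> norm_num, rfl⟩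
  have ho : inner ℂ ψ (applyMatrix (expect p φ • pauliString p) ψ) = (0 : ℂ) := by
    rw [smul_applyMatrix, inner_smul_right]
    exact mul_eq_zero_of_right _ hq
  refine ⟨_, hP, ho, inner ℂ (superpose ψ (applyMatrix (expect p φ • pauliString p) ψ)) φ, ?_, ?_⟩
  · rw [hi, norm_mul, norm_inner_symm, h, Complex.norm_real,
      Real.norm_of_nonneg (Real.sqrt_nonneg 2)]
    field_simp
  · set w := superpose ψ (applyMatrix (expect p φ • pauliString p) ψ)
    have hw : ‖w‖ = 1 := norm_superpose hψ.1 (by rw [norm_pauliGroup_apply hP, hψ.1]) ho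
    have hc : ‖inner ℂ w φ‖ = 1 := by
      rw [hi, norm_mul, norm_inner_symm, h, Complex.norm_real,
        Real.norm_of_nonneg (Real.sqrt_nonneg 2)]
      field_simp
    symm
    -- Equality case of Cauchy–Schwarz: the overlap itself is the phase.
    rw [← inner_eq_one_iff_of_norm_eq_one (𝕜 := ℂ) (by rw [norm_smul, hc, hw, one_mul]) hφ.1,
      inner_smul_left, mul_comm, Complex.mul_conj, Complex.normSq_eq_norm_sq, hc]
    simp

/-! ### Counting Pauli images -/

/-- With `p q = d r`, nonzero overlap forces `r` to fix `ψ` up to sign. Applying `p` to `p q ψ = d r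
ψ` and using `p² = 1` turns this into proportionality of the images. -/
theorem IsStabilizerState.exists_smul_apply_eq {ψ : QubitSpace n} (hψ : IsStabilizerState ψ)
    {P : Matrix (Fin n → Fin 2) (Fin n → Fin 2) ℂ} (hP : P ∈ pauliGroup n)
    {p : Fin n → Literal} (h : inner ℂ (applyMatrix P ψ) (applyMatrix (pauliString p) ψ) ≠ (0 : ℂ)) :
    ∃ c : ℂ, c ^ 4 = 1 ∧ applyMatrix P ψ = c • applyMatrix (pauliString p) ψ := by
  obtain ⟨c, q, hc, rfl⟩ := mem_pauliGroup.1 hP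
  obtain ⟨d, r, hd, hr⟩ := pauliString_mul p q
  rw [smul_applyMatrix, inner_smul_left, ← inner_conj_symm, ← inner_pauliString,
    ← applyMatrix_mul, hr, smul_applyMatrix, inner_smul_right, ← expect] at h
  have hne : expect r ψ ≠ 0 := by
    intro h0
    simp [h0] at h
  have he : expect r ψ ^ 4 = 1 := by
    rcases ((isStabilizerState_iff.1 hψ).2 r).resolve_left hne with e | e <;> rw [e] <;> norm_num
  refine ⟨c * (d * expect r ψ), by rw [mul_pow, mul_pow, hc, hd, he]; norm_num, ?_⟩
  rw [smul_applyMatrix, mul_smul, ← applyMatrix_smul (pauliString p), mul_smul, ← hψ.apply_eq hne,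
    ← smul_applyMatrix d, ← hr, applyMatrix_mul, pauliString_apply_apply]

/-- Each squared overlap is `0` or `1`, so their sum `2 ^ n` counts the nonzero ones. -/
theorem IsStabilizerState.card_inner_ne_zero {ψ : QubitSpace n} (hψ : IsStabilizerState ψ)
    {P : Matrix (Fin n → Fin 2) (Fin n → Fin 2) ℂ} (hP : P ∈ pauliGroup n)
    [DecidablePred fun p : Fin n → Literal =>
      inner ℂ (applyMatrix P ψ) (applyMatrix (pauliString p) ψ) ≠ (0 : ℂ)] :
    (Finset.univ.filter fun p : Fin n → Literal =>
      inner ℂ (applyMatrix P ψ) (applyMatrix (pauliString p) ψ) ≠ (0 : ℂ)).card = 2 ^ n := by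
  have h := sum_norm_inner_sq (a := applyMatrix P ψ) (b := ψ)
    (by rw [norm_pauliGroup_apply hP, hψ.1]) hψ.1
  have h2 : ∀ p : Fin n → Literal, ‖inner ℂ (applyMatrix P ψ) (applyMatrix (pauliString p) ψ)‖ ^ 2 =
      if inner ℂ (applyMatrix P ψ) (applyMatrix (pauliString p) ψ) ≠ (0 : ℂ) then (1 : ℝ)
      else 0 := by
    intro p
    split_ifs with hp
    · obtain ⟨c, hc, he⟩ := hψ.exists_smul_apply_eq hP hp
      rw [he, inner_smul_left, inner_apply_apply, hψ.inner_self, mul_one, RCLike.norm_conj,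
        norm_eq_one_of_pow_four hc, one_pow]
    · rw [not_not.1 hp, norm_zero]
      norm_num
  rw [Finset.sum_congr rfl fun p _ => h2 p, Finset.sum_boole] at h
  exact_mod_cast h

theorem one_mem_pauliGroup : (1 : Matrix (Fin n → Fin 2) (Fin n → Fin 2) ℂ) ∈ pauliGroup n := by
  obtain ⟨c, r, hc, h⟩ := pauliString_mul (fun _ : Fin n => Literal.I) (fun _ => Literal.I)
  rw [pauliString_mul_self] at h
  exact mem_pauliGroup.2 ⟨c, r, hc, h⟩

open Classical in
theorem IsStabilizerState.card_expect_eq_zero {ψ : QubitSpace n} (hψ : IsStabilizerState ψ) :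
    (Finset.univ.filter fun p : Fin n → Literal => expect p ψ = 0).card + 2 ^ n = 4 ^ n := by
  have h := hψ.card_inner_ne_zero one_mem_pauliGroup
  simp only [one_applyMatrix] at h
  have h2 := Finset.card_filter_add_card_filter_not (s := (Finset.univ : Finset (Fin n → Literal)))
    (fun p => expect p ψ = 0)
  rw [Finset.card_univ, Fintype.card_fun, Literal.card_eq, Fintype.card_fin] at h2
  rw [← h, ← h2]
  rfl

/-- The Pauli images of `ψ` that are orthogonal to `ψ`. -/
def orthogonalImages (ψ : QubitSpace n) : Set (QubitSpace n) :=
  {χ | ∃ P ∈ pauliGroup n, applyMatrix P ψ = χ ∧ inner ℂ ψ χ = (0 : ℂ)}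

theorem IsStabilizerState.encard_orthogonalImages {ψ : QubitSpace n} (hψ : IsStabilizerState ψ) :
    (orthogonalImages ψ).encard = ((4 * (2 ^ n - 1) : ℕ) : ℕ∞) := by
  classical
  set f : Fin 4 × (Fin n → Literal) → QubitSpace n :=
    fun x => applyMatrix (Complex.I ^ (x.1 : ℕ) • pauliString x.2) ψ with hf
  set D : Finset (Fin 4 × (Fin n → Literal)) :=
    Finset.univ ×ˢ Finset.univ.filter fun p : Fin n → Literal => expect p ψ = 0 with hD
  have hmem : ∀ x, x ∈ D ↔ inner ℂ ψ (f x) = (0 : ℂ) := by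
    intro x
    rw [hD, Finset.mem_product, Finset.mem_filter]
    simp [hf, smul_applyMatrix, expect]
  have himage : orthogonalImages ψ = (D.image f : Finset (QubitSpace n)) := by
    ext χ
    rw [Finset.coe_image, Set.mem_image]
    constructor
    · rintro ⟨P, ⟨k, p, rfl⟩, rfl, h⟩
      exact ⟨(k, p), (hmem _).2 h, rfl⟩
    · rintro ⟨x, hx, rfl⟩
      exact ⟨_, ⟨x.1, x.2, rfl⟩, rfl, (hmem x).1 hx⟩
  -- The fiber projects bijectively to the strings whose image overlaps `χ`: each of these needs
  -- exactly one phase `i^k` to produce `χ`.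
  have hfiber : ∀ χ ∈ D.image f, (D.filter fun x => f x = χ).card = 2 ^ n := by
    intro χ hχ
    obtain ⟨y, hy, rfl⟩ := Finset.mem_image.1 hχ
    have hP : Complex.I ^ (y.1 : ℕ) • pauliString y.2 ∈ pauliGroup n := ⟨_, _, rfl⟩
    rw [← hψ.card_inner_ne_zero hP]
    refine Finset.card_nbij Prod.snd ?_ ?_ ?_
    · intro x hx
      obtain ⟨-, hx⟩ := Finset.mem_filter.1 hx
      refine Finset.mem_coe.2 (Finset.mem_filter.2 ⟨Finset.mem_univ _, ?_⟩)
      change inner ℂ (f y) _ ≠ 0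
      rw [← hx]
      simp only [hf, smul_applyMatrix, inner_smul_left, inner_apply_apply, hψ.inner_self]
      simp
    · intro x hx z hz hxz
      obtain ⟨-, hx⟩ := Finset.mem_filter.1 hx
      obtain ⟨-, hz⟩ := Finset.mem_filter.1 hz
      refine Prod.ext (I_pow_injective ?_) hxz
      have h : f x = f z := hx.trans hz.symm
      simp only [hf, smul_applyMatrix, hxz] at h
      refine smul_left_injective ℂ ?_ h
      rw [← norm_ne_zero_iff, norm_pauliString_apply, hψ.1]
      exact one_ne_zero
    · intro p hp
      obtain ⟨-, hp⟩ := Finset.mem_filter.1 hp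
      obtain ⟨c, hc, he⟩ := hψ.exists_smul_apply_eq hP hp
      obtain ⟨k, rfl⟩ := exists_eq_I_pow hc
      have hfk : f (k, p) = f y := by rw [hf]; simp only [he, smul_applyMatrix]
      refine ⟨(k, p), Finset.mem_coe.2 (Finset.mem_filter.2 ⟨?_, hfk⟩), rfl⟩
      rw [hmem, hfk, ← hmem]
      exact hy
  have hcard := Finset.card_eq_sum_card_image f D
  rw [Finset.sum_congr rfl hfiber, Finset.sum_const, smul_eq_mul, hD, Finset.card_product,
    Finset.card_univ, Fintype.card_fin, ← hD] at hcard
  rw [himage, Set.encard_coe_eq_coe_finsetCard, Nat.cast_inj]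
  have h := hψ.card_expect_eq_zero
  rw [show (4 : ℕ) ^ n = 2 ^ n * 2 ^ n by rw [← mul_pow]; norm_num] at h
  have hpos : 0 < 2 ^ n := by positivity
  -- Removes the truncated subtraction before cancelling the fiber size `2 ^ n`.
  obtain ⟨m, hm⟩ : ∃ m, 2 ^ n = m + 1 := ⟨2 ^ n - 1, by omega⟩
  rw [hm] at h hcard ⊢
  rw [Nat.add_sub_cancel]
  apply Nat.eq_of_mul_eq_mul_right (Nat.succ_pos m)
  change _ * (m + 1) = _ * (m + 1)
  rw [← hcard]
  linarith

/-! ### Nearest neighbors -/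

theorem norm_inner_eq_one_of_zero {ψ φ : QubitSpace 0} (hψ : ‖ψ‖ = 1) (hφ : ‖φ‖ = 1) :
    ‖inner ℂ ψ φ‖ = 1 := by
  rw [EuclideanSpace.norm_eq, Fintype.sum_unique, Real.sqrt_sq (norm_nonneg _)] at hψ hφ
  rw [PiLp.inner_apply, Fintype.sum_unique, RCLike.inner_apply, norm_mul, RCLike.norm_conj, hψ, hφ,
    one_mul]

theorem isGreatest_overlapsNeOne (hn : 1 ≤ n) {ψ : QubitSpace n} (hψ : IsStabilizerState ψ) :
    IsGreatest (overlapsNeOne ψ) (1 / √2) := by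
  classical
  constructor
  · have h := hψ.card_expect_eq_zero
    have hlt : (2 : ℕ) ^ n < 4 ^ n := Nat.pow_lt_pow_left (by norm_num) (by omega)
    obtain ⟨p, hp⟩ := Finset.card_pos.1 (show 0 < (Finset.univ.filter
      fun p : Fin n → Literal => expect p ψ = 0).card by omega)
    have hp := (Finset.mem_filter.1 hp).2
    have hP : pauliString p ∈ pauliGroup n := mem_pauliGroup.2 ⟨1, p, one_pow _, (one_smul _ _).symm⟩
    exact ⟨_, isStabilizerState_superpose hψ hP hp, norm_inner_superpose hψ.1 hp,
      one_div_sqrt_two_ne_one⟩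
  · rintro r ⟨χ, hχ, rfl, h⟩
    exact norm_inner_le hψ hχ h

theorem isNearestNeighbor_iff {ψ φ : QubitSpace n} (hψ : IsStabilizerState ψ) :
    IsNearestNeighbor ψ φ ↔ IsStabilizerState φ ∧ ‖inner ℂ ψ φ‖ = 1 / √2 := by
  refine and_congr_right fun hφ => ⟨fun h => ?_, fun h => ?_⟩
  · rcases Nat.eq_zero_or_pos n with rfl | hn
    · obtain ⟨χ, hχ, -, h1⟩ := h.1
      exact absurd (norm_inner_eq_one_of_zero hψ.1 hφ.1) h1
    · exact h.unique (isGreatest_overlapsNeOne hn hψ)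
  · rw [h]
    refine ⟨⟨φ, hφ, h, one_div_sqrt_two_ne_one⟩, ?_⟩
    rintro r ⟨χ, hχ, rfl, h1⟩
    exact norm_inner_le hψ hχ h1

theorem isNearestNeighbor_iff_exists {ψ φ : QubitSpace n} (hψ : IsStabilizerState ψ) :
    IsNearestNeighbor ψ φ ↔ ∃ P ∈ pauliGroup n, inner ℂ ψ (applyMatrix P ψ) = 0 ∧
      EqUpToPhase φ (superpose ψ (applyMatrix P ψ)) := by
  rw [isNearestNeighbor_iff hψ]
  constructor
  · rintro ⟨hφ, h⟩
    exact exists_eqUpToPhase_superpose hψ hφ h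
  · rintro ⟨P, hP, h, c, hc, rfl⟩
    refine ⟨(isStabilizerState_superpose hψ hP h).smul hc, ?_⟩
    rw [inner_smul_right, norm_mul, hc, one_mul, norm_inner_superpose hψ.1 h]

theorem encard_nearestNeighborRays {ψ : QubitSpace n} (hψ : IsStabilizerState ψ) :
    (nearestNeighborRays ψ).encard = ((4 * (2 ^ n - 1) : ℕ) : ℕ∞) := by
  have hne : ∀ χ ∈ orthogonalImages ψ, superpose ψ χ ≠ 0 := by
    rintro χ ⟨P, hP, rfl, h⟩
    exact (isStabilizerState_superpose hψ hP h).ne_zero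
  set g : orthogonalImages ψ → Projectivization ℂ (QubitSpace n) :=
    fun χ => Projectivization.mk ℂ (superpose ψ χ) (hne χ χ.2) with hg
  have hrange : nearestNeighborRays ψ = Set.range g := by
    ext L
    constructor
    · rintro ⟨φ, hφ, hn, rfl⟩
      obtain ⟨P, hP, h, c, hc, rfl⟩ := (isNearestNeighbor_iff_exists hψ).1 hn
      refine ⟨⟨_, P, hP, rfl, h⟩, ?_⟩
      rw [hg, eq_comm, Projectivization.mk_eq_mk_iff']
      exact ⟨c, rfl⟩
    · rintro ⟨⟨_, P, hP, rfl, h⟩, rfl⟩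
      exact ⟨_, _, (isNearestNeighbor_iff_exists hψ).2
        ⟨P, hP, h, 1, norm_one, (one_smul _ _).symm⟩, rfl⟩
  have hinj : Function.Injective g := by
    rintro ⟨χ, hχ⟩ ⟨χ', hχ'⟩ h
    obtain ⟨a, ha⟩ := (Projectivization.mk_eq_mk_iff' ℂ _ _ _ _).1 h
    -- Both superpositions have the same overlap `1/√2` with `ψ`, which forces the scalar to be `1`.
    have h1 := congrArg (inner ℂ ψ) ha
    obtain ⟨_, _, _, h2⟩ := id hχ
    obtain ⟨_, _, _, h3⟩ := id hχ'
    have hs : ((√2 : ℝ) : ℂ)⁻¹ ≠ 0 := by simp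
    change inner ℂ ψ (a • superpose ψ χ') = inner ℂ ψ (superpose ψ χ) at h1
    rw [inner_smul_right, inner_superpose hψ.1 h2, inner_superpose hψ.1 h3] at h1
    have ha1 : a = 1 := by
      apply mul_right_cancel₀ hs
      rw [h1, one_mul]
    rw [ha1, one_smul] at ha
    have h4 := smul_right_injective (QubitSpace n) hs ha
    exact Subtype.ext (add_left_cancel h4).symm
  rw [hrange, ← Set.image_univ, hinj.encard_image, Set.encard_univ, ← hψ.encard_orthogonalImages]
  rfl

/-! ### The all-zero computational basis state -/

theorem inner_basisState (x y : Fin n → Fin 2) :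
    inner ℂ (basisState x) (basisState y) = if x = y then (1 : ℂ) else 0 := by
  simp only [basisState, EuclideanSpace.inner_single_left, map_one, one_mul]
  simp

theorem applyMatrix_basisState_apply (M : Matrix (Fin n → Fin 2) (Fin n → Fin 2) ℂ)
    (x y : Fin n → Fin 2) : applyMatrix M (basisState x) y = M y x := by
  simp [applyMatrix, basisState]

/-- The expectation is a product of upper-left entries, each `1` (for `I`, `Z`) or `0` (for `X`,
`Y`). -/
theorem isStabilizerState_basisState_zero :
    IsStabilizerState (basisState (0 : Fin n → Fin 2)) := by
  rw [isStabilizerState_iff]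
  refine ⟨by simp [basisState], fun p => ?_⟩
  have h : expect p (basisState 0) = ∏ j, (p j).toMatrix 0 0 := by
    rw [expect, basisState, EuclideanSpace.inner_single_left, ← basisState,
      applyMatrix_basisState_apply, pauliString_apply]
    simp
  rw [h]
  by_cases hp : ∃ j, (p j).toMatrix 0 0 = 0
  · obtain ⟨j, hj⟩ := hp
    exact Or.inl (Finset.prod_eq_zero (Finset.mem_univ j) hj)
  · push Not at hp
    refine Or.inr (Or.inl (Finset.prod_eq_one fun j _ => ?_))
    have := hp j
    revert this
    cases p j <;> simp [Literal.toMatrix]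

theorem Literal.exists_toMatrix_zero (l : Literal) :
    ∃ (c : ℂ) (b : Fin 2), c ^ 4 = 1 ∧ ∀ a, l.toMatrix a 0 = if a = b then c else 0 := by
  cases l
  · exact ⟨1, 0, one_pow _, fun a => by fin_cases a <;> simp [Literal.toMatrix]⟩
  · exact ⟨1, 1, one_pow _, fun a => by fin_cases a <;> simp [Literal.toMatrix]⟩
  · exact ⟨Complex.I, 1, Complex.I_pow_four, fun a => by fin_cases a <;> simp [Literal.toMatrix]⟩
  · exact ⟨1, 0, one_pow _, fun a => by fin_cases a <;> simp [Literal.toMatrix]⟩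

theorem exists_pauliString_basisState_zero (p : Fin n → Literal) :
    ∃ (c : ℂ) (x : Fin n → Fin 2), c ^ 4 = 1 ∧
      applyMatrix (pauliString p) (basisState 0) = c • basisState x := by
  choose c b hc h using Literal.exists_toMatrix_zero
  refine ⟨∏ j, c (p j), fun j => b (p j), ?_, ?_⟩
  · rw [← Finset.prod_pow]
    exact Finset.prod_eq_one fun j _ => hc _
  · ext y
    rw [applyMatrix_basisState_apply, pauliString_apply]
    simp only [Pi.zero_apply, h, Finset.prod_ite_zero, Finset.mem_univ, true_imp_iff]
    simp [basisState, funext_iff]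

theorem exists_pauliString_eq_basisState (x : Fin n → Fin 2) :
    ∃ p : Fin n → Literal, applyMatrix (pauliString p) (basisState 0) = basisState x := by
  -- Flip exactly the bits set in `x`.
  refine ⟨fun j => if x j = 0 then .I else .X, ?_⟩
  have h : ∀ a b : Fin 2, (if b = 0 then Literal.I else Literal.X).toMatrix a 0 =
      if a = b then 1 else 0 := by
    intro a b
    fin_cases a <;> fin_cases b <;> simp [Literal.toMatrix]
  ext y
  rw [applyMatrix_basisState_apply, pauliString_apply]
  simp only [Pi.zero_apply, h, Finset.prod_ite_zero, Finset.mem_univ, true_imp_iff]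
  simp [basisState, funext_iff]

theorem isNearestNeighbor_basisState_zero_iff {φ : QubitSpace n} :
    IsNearestNeighbor (basisState (0 : Fin n → Fin 2)) φ ↔
      ∃ (x : Fin n → Fin 2) (t : Fin 4), x ≠ 0 ∧
        EqUpToPhase φ (superpose (basisState 0) (Complex.I ^ (t : ℕ) • basisState x)) := by
  rw [isNearestNeighbor_iff_exists isStabilizerState_basisState_zero]
  constructor
  · rintro ⟨P, hP, h, hφ⟩
    obtain ⟨c, p, hc, rfl⟩ := mem_pauliGroup.1 hP
    obtain ⟨d, x, hd, hp⟩ := exists_pauliString_basisState_zero p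
    obtain ⟨t, ht⟩ := exists_eq_I_pow (c := c * d) (by rw [mul_pow, hc, hd, one_mul])
    rw [smul_applyMatrix, hp, smul_smul, ht] at h hφ
    refine ⟨x, t, ?_, hφ⟩
    rintro rfl
    rw [inner_smul_right, inner_basisState, if_pos rfl, mul_one] at h
    exact pow_ne_zero _ Complex.I_ne_zero h
  · rintro ⟨x, t, hx, hφ⟩
    obtain ⟨p, hp⟩ := exists_pauliString_eq_basisState x
    refine ⟨Complex.I ^ (t : ℕ) • pauliString p, ⟨t, p, rfl⟩, ?_⟩
    rw [smul_applyMatrix, hp]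
    refine ⟨?_, hφ⟩
    rw [inner_smul_right, inner_basisState, if_neg hx.symm, mul_zero]

end

end QubitStab

theorem mainTheorem1 (n : ℕ) :
    (∀ ψ : QubitStab.QubitSpace n, QubitStab.IsStabilizerState ψ →
      (QubitStab.nearestNeighborRays ψ).encard = ((4 * (2 ^ n - 1) : ℕ) : ℕ∞) ∧
      (1 ≤ n → IsGreatest (QubitStab.overlapsNeOne ψ) (1 / √2)) ∧
      (∀ φ : QubitStab.QubitSpace n, QubitStab.IsNearestNeighbor ψ φ ↔
        ∃ P ∈ QubitStab.pauliGroup n, inner ℂ ψ (QubitStab.applyMatrix P ψ) = 0 ∧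
          QubitStab.EqUpToPhase φ (QubitStab.superpose ψ (QubitStab.applyMatrix P ψ)))) ∧
    QubitStab.IsStabilizerState (QubitStab.basisState (0 : Fin n → Fin 2)) ∧
    (∀ φ : QubitStab.QubitSpace n,
      QubitStab.IsNearestNeighbor (QubitStab.basisState (0 : Fin n → Fin 2)) φ ↔
        ∃ (x : Fin n → Fin 2) (t : Fin 4), x ≠ 0 ∧
          QubitStab.EqUpToPhase φ (QubitStab.superpose (QubitStab.basisState 0)
            (Complex.I ^ (t : ℕ) • QubitStab.basisState x))) :=
  ⟨fun _ hψ => ⟨QubitStab.encard_nearestNeighborRays hψ,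
      fun hn => QubitStab.isGreatest_overlapsNeOne hn hψ,
      fun _ => QubitStab.isNearestNeighbor_iff_exists hψ⟩,
    QubitStab.isStabilizerState_basisState_zero,
    fun _ => QubitStab.isNearestNeighbor_basisState_zero_iff⟩
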